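/- Let $E$ be a locally compact Hausdorff space with a countable base, equipped with its Borel $\sigma$-algebra, and let $obs : E \to [0,1]$ be continuous. Let $\Omega$ be the space of continuous maps $\omega : [0,\infty) \to E$ with the topology of locally uniform convergence (compact-open topology) and the $\sigma$-algebra generated by the evaluations $X_t(\omega) = \omega(t)$. Let $(\hat P_t)_{t \ge 0}$ be an honest Feller–Dynkin semigroup on $C_0(E)$, i.e. a strongly continuous semigroup of bounded linear operators on $C_0(E)$ such that $0 \le f \le 1$ implies $0 \le \hat P_t f \le 1$, and whose kernels $P_t$, determined by $\hat P_t f(x) = \int f \, dP_t(x)$ for $f \in C_0(E)$, are Markov kernels. Assume that the associated process is a diffusion: for every $x \in E$ there is a probability measure $\mathbb{P}^x$ on $\Omega$ under which $$\mathbb{P}^x(X_0 \in dx_0, X_{t_1} \in dx_1, \dots, X_{t_n} \in dx_n) = \delta_x(dx_0)\, P_{t_1}(x_0, dx_1) \cdots P_{t_n - t_{n-1}}(x_{n-1}, dx_n)$$ for all $0 < t_1 < \dots < t_n$, and $x \mapsto \mathbb{P}^x$ is weakly continuous. Fix $0 < c < 1$. For a lower semicontinuous pseudometric $m : E \times E \to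 [0,1]$ put $$U_c(m)(\omega, \omega') = \sup_{t \ge 0} c^t\, m(\omega(t), \omega'(t)), \qquad \mathcal{G}_c(m)(x,y) = \inf_{\gamma} \int U_c(m) \, d\gamma,$$ where $\gamma$ ranges over the couplings of $\mathbb{P}^x$ and $\mathbb{P}^y$. Let $d_0^c(x,y) = |obs(x) - obs(y)|$, $d_{n+1}^c = \mathcal{G}_c(d_n^c)$ for $n \ge 0$, and $\overline{d}^c = \sup_{n \ge 0} d_n^c$. Then $\overline{d}^c$ is a lower semicontinuous 1-bounded pseudometric on $E$ with $\mathcal{G}_c(\overline{d}^c) = \overline{d}^c$ and $\overline{d}^c(x,y) \ge |obs(x) - obs(y)|$ for all $x, y \in E$, and every lower semicontinuous 1-bounded pseudometric $m$ on $E$ with $\mathcal{G}_c(m) = m$ and $m(x,y) \ge |obs(x) - obs(y)|$ for all $x,y \in E$ satisfies $m \ge \overline{d}^c$ pointwise. That is, $\overline{d}^c$ is the least fixpoint of $\mathcal{G}_c$ among lower semicontinuous 1-bounded pseudometrics that dominate $(x,y) \mapsto |obs(x) - obs(y)|$. -/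

import Mathlib

open MeasureTheory ProbabilityTheory Filter Topology
open scoped NNReal ENNReal ZeroAtInfty BoundedContinuousFunction

noncomputable section

namespace TrajectoryMetric

/-! ### Feller-Dynkin semigroups and diffusions -/

/-- A Feller-Dynkin semigroup: a strongly continuous semigroup of bounded linear operators on
`C₀(E)` such that `0 ≤ f ≤ 1` implies `0 ≤ P̂ₜ f ≤ 1`. -/
structure FDSemigroup (E : Type*) [TopologicalSpace E] where
  /-- the operators `P̂ₜ` -/
  op : ℝ≥0 → (C₀(E, ℝ) →L[ℝ] C₀(E, ℝ))
  op_zero : op 0 = ContinuousLinearMap.id ℝ C₀(E, ℝ)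
  op_comp : ∀ s t : ℝ≥0, (op s).comp (op t) = op (s + t)
  strongly_continuous : ∀ f : C₀(E, ℝ), Tendsto (fun t : ℝ≥0 => ‖op t f - f‖) (𝓝[>] 0) (𝓝 0)
  op_mem_Icc : ∀ (t : ℝ≥0) (f : C₀(E, ℝ)), (∀ x, 0 ≤ f x ∧ f x ≤ 1) →
    ∀ x, 0 ≤ op t f x ∧ op t f x ≤ 1

/-- An honest Feller-Dynkin semigroup: the kernels `Pₜ` with `P̂ₜ f (x) = ∫ f dPₜ(x)` for all
`f ∈ C₀(E)`, which are uniquely determined by the semigroup, have total mass `1`. -/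
structure HonestFDSemigroup (E : Type*) [TopologicalSpace E] [MeasurableSpace E]
    extends FDSemigroup E where
  /-- the transition kernels `Pₜ` -/
  kernel : ℝ≥0 → Kernel E E
  op_eq_integral : ∀ (t : ℝ≥0) (f : C₀(E, ℝ)) (x : E), op t f x = ∫ y, f y ∂(kernel t x)
  honest : ∀ t : ℝ≥0, IsMarkovKernel (kernel t)

/-- The trajectory space `Ω`: continuous maps `[0, ∞) → E`, with Mathlib's compact-open topology
(uniform convergence on bounded time intervals). -/
abbrev Trajectory (E : Type*) [TopologicalSpace E] : Type _ := C(ℝ≥0, E)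

/-- The σ-algebra `σ(X_s | s ≥ 0)` on `Ω` generated by the evaluations `X_s(ω) = ω(s)`. -/
instance instMeasurableSpaceTrajectory (E : Type*) [TopologicalSpace E] [MeasurableSpace E] :
    MeasurableSpace (Trajectory E) :=
  ⨆ s : ℝ≥0, MeasurableSpace.comap (fun ω : Trajectory E => ω s) inferInstance

/-- For `s < t₁ < ⋯ < tₙ`, the value of `cylinderProb P s x [(t₁, C₁), …, (tₙ, Cₙ)]` is
`∫_{C₁} P_{t₁ - s}(x, dx₁) ∫_{C₂} P_{t₂ - t₁}(x₁, dx₂) ⋯ ∫_{Cₙ} P_{tₙ - tₙ₋₁}(xₙ₋₁, dxₙ)`. -/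
def cylinderProb {E : Type*} [MeasurableSpace E] (P : ℝ≥0 → Kernel E E) :
    ℝ≥0 → E → List (ℝ≥0 × Set E) → ℝ≥0∞
  | _, _, [] => 1
  | s, x, (t, C) :: l => ∫⁻ y in C, cylinderProb P t y l ∂(P (t - s) x)

/-- `Q` is the law `ℙ^μ` on `Ω` with initial distribution `μ` and transition kernels `P`: for
`0 < t₁ < ⋯ < tₙ` and measurable `C₀, C₁, …, Cₙ`, the probability
`Q(X₀ ∈ C₀, X_{t₁} ∈ C₁, …, X_{tₙ} ∈ Cₙ)` equals
`∫_{C₀} μ(dx₀) ∫_{C₁} P_{t₁}(x₀, dx₁) ⋯ ∫_{Cₙ} P_{tₙ - tₙ₋₁}(xₙ₋₁, dxₙ)`. -/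
def IsLawFrom {E : Type*} [TopologicalSpace E] [MeasurableSpace E] (P : ℝ≥0 → Kernel E E)
    (μ : Measure E) (Q : Measure (Trajectory E)) : Prop :=
  ∀ (C₀ : Set E) (l : List (ℝ≥0 × Set E)), MeasurableSet C₀ → (∀ p ∈ l, MeasurableSet p.2) →
    List.IsChain (· < ·) (0 :: l.map Prod.fst) →
      Q {ω | ω 0 ∈ C₀ ∧ ∀ p ∈ l, ω p.1 ∈ p.2} = ∫⁻ x in C₀, cylinderProb P 0 x l ∂μ

/-- A diffusion: an honest Feller-Dynkin process whose trajectories are continuous, so that its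
laws `ℙ^x` live on `Ω = C([0, ∞), E)`, and for which `x ↦ ℙ^x` is weakly continuous. -/
structure Diffusion (E : Type*) [TopologicalSpace E] [MeasurableSpace E]
    extends HonestFDSemigroup E where
  /-- the law `ℙ^x` of the process started at `x` -/
  law : E → ProbabilityMeasure (Trajectory E)
  isLawFrom : ∀ x : E, IsLawFrom kernel (Measure.dirac x) (law x : Measure (Trajectory E))
  weakly_continuous : ∀ (u : ℕ → E) (x : E), Tendsto u atTop (𝓝 x) →
    ∀ f : Trajectory E →ᵇ ℝ,
      Tendsto (fun n => ∫ ω, f ω ∂(law (u n) : Measure (Trajectory E))) atTop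
        (𝓝 (∫ ω, f ω ∂(law x : Measure (Trajectory E))))

/-! ### Lattices of pseudometrics -/

/-- The lattice `𝓜` of 1-bounded pseudometrics on a set, as real functions of two arguments
ordered pointwise. -/
structure IsBoundedPseudometric {X : Type*} (m : X → X → ℝ) : Prop where
  nonneg : ∀ x y, 0 ≤ m x y
  le_one : ∀ x y, m x y ≤ 1
  self : ∀ x, m x x = 0
  symm : ∀ x y, m x y = m y x
  triangle : ∀ x y z, m x z ≤ m x y + m y z

/-- The lattice `𝓟` of lower semicontinuous 1-bounded pseudometrics. -/
structure IsLscPseudometric {X : Type*} [TopologicalSpace X] (m : X → X → ℝ) : Prop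
    extends IsBoundedPseudometric m where
  lsc : LowerSemicontinuous fun p : X × X => m p.1 p.2

/-! ### Optimal transport -/

/-- The set `Γ(μ, ν)` of couplings of two probability measures. -/
def couplings {X Y : Type*} [MeasurableSpace X] [MeasurableSpace Y] (μ : ProbabilityMeasure X)
    (ν : ProbabilityMeasure Y) : Set (ProbabilityMeasure (X × Y)) :=
  {γ | (γ : Measure (X × Y)).map Prod.fst = (μ : Measure X) ∧
    (γ : Measure (X × Y)).map Prod.snd = (ν : Measure Y)}

/-- The optimal transport cost `W(k)(μ, ν)` for the cost function `k`. -/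
def transportCost {X : Type*} [MeasurableSpace X] (k : X → X → ℝ) (μ ν : ProbabilityMeasure X) :
    ℝ :=
  sInf ((fun γ : ProbabilityMeasure (X × X) => ∫ p, k p.1 p.2 ∂(γ : Measure (X × X))) ''
    couplings μ ν)

/-! ### The functional and its iterates -/

/-- The discounted uniform pseudometric `U_c(m)(ω, ω') = sup_t c^t m(ω(t), ω'(t))`. -/
def discountedUniform {E : Type*} [TopologicalSpace E] (c : ℝ) (m : E → E → ℝ)
    (ω ω' : Trajectory E) : ℝ :=
  ⨆ t : ℝ≥0, c ^ (t : ℝ) * m (ω t) (ω' t)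

/-- The functional `𝓖_c(m)(x, y) = W(U_c(m))(ℙ^x, ℙ^y)`. -/
def Diffusion.functional {E : Type*} [TopologicalSpace E] [MeasurableSpace E] (D : Diffusion E)
    (c : ℝ) (m : E → E → ℝ) : E → E → ℝ :=
  fun x y => transportCost (discountedUniform c m) (D.law x) (D.law y)

/-- The pseudometric `(x, y) ↦ |obs(x) - obs(y)|`. -/
def obsDist {E : Type*} [TopologicalSpace E] (obs : C(E, unitInterval)) : E → E → ℝ :=
  fun x y => |(obs x : ℝ) - (obs y : ℝ)|

/-- The sequence `d₀ = |obs(·) - obs(·)|`, `dₙ₊₁ = 𝓖_c(dₙ)`. -/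
def Diffusion.iterate {E : Type*} [TopologicalSpace E] [MeasurableSpace E] (D : Diffusion E)
    (obs : C(E, unitInterval)) (c : ℝ) : ℕ → E → E → ℝ
  | 0 => obsDist obs
  | n + 1 => D.functional c (D.iterate obs c n)

/-- The pseudometric `d̄^c = sup_n dₙ`. -/
def Diffusion.dbar {E : Type*} [TopologicalSpace E] [MeasurableSpace E] (D : Diffusion E)
    (obs : C(E, unitInterval)) (c : ℝ) : E → E → ℝ :=
  fun x y => ⨆ n : ℕ, D.iterate obs c n x y

end TrajectoryMetric

end

/-! On lower semicontinuous 1-bounded pseudometrics the functional is monotone. It is also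
inflationary, because under any coupling of `ℙ^x` and `ℙ^y` the trajectories almost surely start at
`x` and `y`, where the discount is `1` (`Diffusion.le_functional`). Hence the iterates increase, and
by induction they stay below every fixpoint that dominates `obsDist obs`.

What remains is that the functional preserves lower semicontinuity and that `𝓖_c(d̄) ≤ d̄`. Both
rest on compactness. The trajectory space is Polish and its evaluation σ-algebra is Borel, so
Prokhorov's theorem makes couplings of convergent laws subconverge to a coupling of the limits
(`exists_subseq_tendsto_coupling`). Integrals of bounded lower semicontinuous costs can only drop in
the limit (`integral_le_of_tendsto`). This gives optimal couplings, lower semicontinuity and, with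
`exists_gluing`, the triangle inequality.

For the fixpoint, let `γ` be a subsequential limit of optimal couplings `γₙ` for `U_c(dₙ)`. For
fixed `m`, monotonicity in `n` bounds `∫ U_c(d_m) dγ` by `d̄`; monotone convergence in `m` then
bounds `∫ U_c(d̄) dγ` (`transportCost_le_of_monotone_tendsto`). -/

namespace TrajectoryMetric

/-! ### Topology and measurable structure of the trajectory space -/

/-- A dense embedding of a locally compact space into a Hausdorff space is open. -/
theorem isOpenEmbedding_of_isDenseEmbedding {X Y : Type*} [TopologicalSpace X]
    [TopologicalSpace Y] [LocallyCompactSpace X] [T2Space Y] {i : X → Y}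
    (hi : IsDenseEmbedding i) : IsOpenEmbedding i := by
  refine ⟨hi.isEmbedding, isOpen_iff_mem_nhds.2 ?_⟩
  rintro _ ⟨x, rfl⟩
  obtain ⟨K, hK, hxK⟩ := exists_compact_mem_nhds x
  obtain ⟨V, hV, hVK⟩ := hi.isInducing.nhds_eq_comap x ▸ hxK
  obtain ⟨W, hWV, hW, hxW⟩ := mem_nhds_iff.1 hV
  refine mem_of_superset (hW.mem_nhds hxW) ?_
  -- By density the open set `W` lies in the closure of its trace on the range, and that trace is
  -- contained in the closed set `i '' K`.
  have hcl : IsClosed (i '' K) := (hK.image hi.continuous).isClosed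
  calc W ⊆ closure (W ∩ Set.range i) := hi.dense.open_subset_closure_inter hW
    _ ⊆ i '' K := closure_minimal (by
        rintro _ ⟨hyW, y, rfl⟩
        exact ⟨y, hVK (hWV hyW), rfl⟩) hcl
    _ ⊆ Set.range i := Set.image_subset_range _ _

/-- A locally compact Hausdorff space with a countable base is Polish. -/
theorem polishSpace_of_locallyCompactSpace (E : Type*) [TopologicalSpace E]
    [LocallyCompactSpace E] [T2Space E] [SecondCountableTopology E] : PolishSpace E := by
  let := TopologicalSpace.metrizableSpaceMetric E
  -- The chosen metric need not be complete, but `E` is open in its completion, and open subsets of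
  -- Polish spaces are Polish.
  have hi : IsOpenEmbedding ((↑) : E → UniformSpace.Completion E) :=
    isOpenEmbedding_of_isDenseEmbedding UniformSpace.Completion.isDenseEmbedding_coe
  have := hi.isOpen_range.polishSpace
  exact hi.isEmbedding.toHomeomorph.isClosedEmbedding.polishSpace

/-- The space of trajectories in a Polish space is Polish. -/
theorem polishSpace_trajectory (E : Type*) [TopologicalSpace E] [PolishSpace E] :
    PolishSpace (Trajectory E) := by
  let := TopologicalSpace.upgradeIsCompletelyMetrizable E
  infer_instance

theorem measurable_trajectory_eval {E : Type*} [TopologicalSpace E] [MeasurableSpace E] (t : ℝ≥0) :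
    Measurable fun ω : Trajectory E => ω t :=
  (comap_measurable _).mono (le_iSup (fun s : ℝ≥0 =>
    MeasurableSpace.comap (fun ω : Trajectory E => ω s) inferInstance) t) le_rfl

/-- The condition `ω(K) ⊆ U`, for `K` compact and `U` open, depends measurably on the values of
the trajectory `ω`. -/
theorem measurableSet_mapsTo {E : Type*} [TopologicalSpace E] [PolishSpace E] [MeasurableSpace E]
    [BorelSpace E] {K : Set ℝ≥0} (hK : IsCompact K) {U : Set E} (hU : IsOpen U) :
    MeasurableSet {ω : Trajectory E | Set.MapsTo ω K U} := by
  let := TopologicalSpace.upgradeIsCompletelyMetrizable E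
  obtain ⟨D, hDK, hD, hKD⟩ := TopologicalSpace.IsSeparable.of_separableSpace K
    |>.exists_countable_dense_subset
  -- The compact set `ω(K)` lies in `U` exactly when it keeps a positive distance from `Uᶜ`; by
  -- continuity this bound need only be checked on the countable dense set `D`.
  have key : {ω : Trajectory E | Set.MapsTo ω K U} =
      ⋃ n : ℕ, ⋂ t ∈ D, {ω : Trajectory E | ((n : ℝ≥0∞) + 1)⁻¹ ≤ Metric.infEDist (ω t) Uᶜ} := by
    ext ω
    simp only [Set.mem_ofPred_eq, Set.mem_iUnion, Set.mem_iInter]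
    have hg : Continuous fun t => Metric.infEDist (ω t) Uᶜ :=
      Metric.continuous_infEDist.comp ω.continuous
    constructor
    · intro h
      rcases K.eq_empty_or_nonempty with rfl | hne
      · exact ⟨0, fun t ht => (hDK ht).elim⟩
      obtain ⟨s, hs, hmin⟩ := hK.exists_isMinOn hne hg.continuousOn
      have hpos : Metric.infEDist (ω s) Uᶜ ≠ 0 := fun h0 =>
        (Metric.mem_iff_infEDist_zero_of_closed hU.isClosed_compl).2 h0 (h hs)
      obtain ⟨n, hn⟩ := ENNReal.exists_inv_nat_lt hpos
      refine ⟨n, fun t ht => ?_⟩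
      calc ((n : ℝ≥0∞) + 1)⁻¹ ≤ (n : ℝ≥0∞)⁻¹ := ENNReal.inv_le_inv.2 le_self_add
        _ ≤ _ := hn.le.trans (hmin (hDK ht))
    · rintro ⟨n, hn⟩ t ht
      have hcl : closure D ⊆ {t | ((n : ℝ≥0∞) + 1)⁻¹ ≤ Metric.infEDist (ω t) Uᶜ} :=
        closure_minimal hn (isClosed_le continuous_const hg)
      by_contra hU'
      have h0 : ((n : ℝ≥0∞) + 1)⁻¹ ≤ Metric.infEDist (ω t) Uᶜ := hcl (hKD ht)
      rw [Metric.infEDist_zero_of_mem hU'] at h0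
      simp at h0
  rw [key]
  refine MeasurableSet.iUnion fun n => MeasurableSet.biInter hD fun t _ => ?_
  exact measurableSet_le measurable_const (measurable_infEDist.comp (measurable_trajectory_eval t))

/-- The σ-algebra generated by the evaluations is the Borel σ-algebra of the trajectory space. -/
theorem borelSpace_trajectory (E : Type*) [TopologicalSpace E] [PolishSpace E] [MeasurableSpace E]
    [BorelSpace E] : BorelSpace (Trajectory E) := by
  refine ⟨le_antisymm (iSup_le fun s => ?_) ?_⟩
  · rw [← measurable_iff_comap_le, BorelSpace.measurable_eq (α := E)]
    exact (continuous_eval_const s : Continuous fun ω : Trajectory E => ω s).borel_measurable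
  · rw [borel_eq_generateFrom_of_subbasis ContinuousMap.compactOpen_eq]
    refine MeasurableSpace.generateFrom_le ?_
    rintro _ ⟨K, hK, U, hU, rfl⟩
    exact measurableSet_mapsTo hK hU

/-! ### Integrals of lower semicontinuous functions -/

theorem integrable_of_lowerSemicontinuous {X : Type*} [TopologicalSpace X] [MeasurableSpace X]
    [OpensMeasurableSpace X] {f : X → ℝ} (hf : LowerSemicontinuous f) (h0 : ∀ x, 0 ≤ f x)
    (h1 : ∀ x, f x ≤ 1) (μ : Measure X) [IsFiniteMeasure μ] : Integrable f μ :=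
  Integrable.of_bound hf.measurable.aestronglyMeasurable 1
    (ae_of_all _ fun x => by rw [Real.norm_of_nonneg (h0 x)]; exact h1 x)

/-- Sublevel sets of the integral of a bounded lower semicontinuous function are closed under
weak convergence. -/
theorem integral_le_of_tendsto {X : Type*} [TopologicalSpace X] [MeasurableSpace X]
    [OpensMeasurableSpace X] [HasOuterApproxClosed X] {f : X → ℝ} (hf : LowerSemicontinuous f)
    (h0 : ∀ x, 0 ≤ f x) (h1 : ∀ x, f x ≤ 1) {γs : ℕ → ProbabilityMeasure X}
    {γ : ProbabilityMeasure X} (hγ : Tendsto γs atTop (𝓝 γ)) {r : ℝ}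
    (hr : ∀ᶠ n in atTop, ∫ x, f x ∂(γs n : Measure X) ≤ r) :
    ∫ x, f x ∂(γ : Measure X) ≤ r := by
  have hr0 : 0 ≤ r := by
    obtain ⟨n, hn⟩ := hr.exists
    exact (integral_nonneg h0).trans hn
  -- The layer-cake formula reduces the claim to the superlevel sets, which are open, so the
  -- portmanteau theorem and Fatou's lemma apply.
  have hof : ∀ μ : ProbabilityMeasure X, ENNReal.ofReal (∫ x, f x ∂(μ : Measure X)) =
      ∫⁻ t in Set.Ioi (0 : ℝ), (μ : Measure X) {x | t < f x} := fun μ => by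
    rw [ofReal_integral_eq_lintegral_ofReal
      (integrable_of_lowerSemicontinuous hf h0 h1 _) (ae_of_all _ h0),
      lintegral_eq_lintegral_meas_lt _ (ae_of_all _ h0) hf.measurable.aemeasurable]
  rw [← ENNReal.ofReal_le_ofReal_iff hr0, hof]
  calc ∫⁻ t in Set.Ioi (0 : ℝ), (γ : Measure X) {x | t < f x}
      ≤ ∫⁻ t in Set.Ioi (0 : ℝ), atTop.liminf fun n => (γs n : Measure X) {x | t < f x} :=
        lintegral_mono fun t =>
          ProbabilityMeasure.le_liminf_measure_open_of_tendsto hγ (hf.isOpen_preimage t)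
    _ ≤ atTop.liminf fun n => ∫⁻ t in Set.Ioi (0 : ℝ), (γs n : Measure X) {x | t < f x} :=
        lintegral_liminf_le fun n => Antitone.measurable fun s t hst =>
          measure_mono fun x hx => lt_of_le_of_lt hst hx
    _ ≤ ENNReal.ofReal r := by
        refine liminf_le_of_frequently_le' (Eventually.frequently ?_)
        filter_upwards [hr] with n hn
        rw [← hof]
        exact ENNReal.ofReal_le_ofReal hn

/-! ### Couplings -/

section Couplings

variable {X Y Z : Type*} [MeasurableSpace X] [MeasurableSpace Y] [MeasurableSpace Z]

theorem couplings_nonempty (μ : ProbabilityMeasure X) (ν : ProbabilityMeasure Y) :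
    (couplings μ ν).Nonempty :=
  ⟨μ.prod ν, by simp [couplings, ProbabilityMeasure.toMeasure_prod]⟩

theorem swap_mem_couplings {μ : ProbabilityMeasure X} {ν : ProbabilityMeasure Y}
    {γ : ProbabilityMeasure (X × Y)} (hγ : γ ∈ couplings μ ν) :
    γ.map measurable_swap.aemeasurable ∈ couplings ν μ := by
  refine ⟨?_, ?_⟩
  · rw [ProbabilityMeasure.toMeasure_map, Measure.map_map measurable_fst measurable_swap]
    exact hγ.2
  · rw [ProbabilityMeasure.toMeasure_map, Measure.map_map measurable_snd measurable_swap]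
    exact hγ.1

theorem diag_mem_couplings (μ : ProbabilityMeasure X) :
    μ.map (measurable_id.prodMk measurable_id).aemeasurable ∈ couplings μ μ := by
  refine ⟨?_, ?_⟩
  · rw [ProbabilityMeasure.toMeasure_map, Measure.map_map measurable_fst
      (measurable_id.prodMk measurable_id)]
    exact Measure.map_id
  · rw [ProbabilityMeasure.toMeasure_map, Measure.map_map measurable_snd
      (measurable_id.prodMk measurable_id)]
    exact Measure.map_id

/-- Gluing: couplings of `μ, ν` and of `ν, ρ` are the marginals of a probability measure on the
triple product. -/
theorem exists_gluing [StandardBorelSpace X] [StandardBorelSpace Z] {μ : ProbabilityMeasure X}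
    {ν : ProbabilityMeasure Y} {ρ : ProbabilityMeasure Z} {γ₁ : ProbabilityMeasure (X × Y)}
    {γ₂ : ProbabilityMeasure (Y × Z)} (h₁ : γ₁ ∈ couplings μ ν) (h₂ : γ₂ ∈ couplings ν ρ) :
    ∃ τ : ProbabilityMeasure (Y × X × Z),
      (τ : Measure (Y × X × Z)).map (fun p => (p.2.1, p.1)) = γ₁ ∧
      (τ : Measure (Y × X × Z)).map (fun p => (p.1, p.2.2)) = γ₂ := by
  have : Nonempty X := (μ : Measure X).nonempty_of_neZero
  have : Nonempty Z := (ρ : Measure Z).nonempty_of_neZero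
  -- Disintegration is over the first factor, so the shared space `Y` is moved there.
  set γ₁' : Measure (Y × X) := (γ₁ : Measure (X × Y)).map Prod.swap with hγ₁'
  have : IsProbabilityMeasure γ₁' := Measure.isProbabilityMeasure_map (by fun_prop)
  have hfst₁ : γ₁'.fst = ν := by
    rw [Measure.fst, hγ₁', Measure.map_map measurable_fst measurable_swap]
    exact h₁.2
  have hfst₂ : (γ₂ : Measure (Y × Z)).fst = ν := h₂.1
  have hd₁ : (ν : Measure Y) ⊗ₘ γ₁'.condKernel = γ₁' := by
    rw [← hfst₁]; exact γ₁'.disintegrate _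
  have hd₂ : (ν : Measure Y) ⊗ₘ (γ₂ : Measure (Y × Z)).condKernel = γ₂ := by
    rw [← hfst₂]; exact (γ₂ : Measure (Y × Z)).disintegrate _
  -- Given the `Y`-coordinate, the other two are made conditionally independent.
  refine ⟨⟨(ν : Measure Y) ⊗ₘ (γ₁'.condKernel ×ₖ (γ₂ : Measure (Y × Z)).condKernel),
    inferInstance⟩, ?_, ?_⟩
  · have hmap : (fun p : Y × X × Z => (p.2.1, p.1)) = Prod.swap ∘ Prod.map id Prod.fst := rfl
    rw [ProbabilityMeasure.coe_mk, hmap, ← Measure.map_map measurable_swap (by fun_prop),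
      ← Measure.compProd_map measurable_fst, ← Kernel.fst_eq, Kernel.fst_prod, hd₁, hγ₁',
      Measure.map_map measurable_swap measurable_swap]
    simp
  · have hmap : (fun p : Y × X × Z => (p.1, p.2.2)) = Prod.map id Prod.snd := rfl
    rw [ProbabilityMeasure.coe_mk, hmap, ← Measure.compProd_map measurable_snd, ← Kernel.snd_eq,
      Kernel.snd_prod, hd₂]

end Couplings

/-- The marginals of a set of couplings being tight, so is the set of couplings. -/
theorem isTightMeasureSet_of_marginals {X Y : Type*} [TopologicalSpace X] [MeasurableSpace X]
    [OpensMeasurableSpace X] [T2Space X] [TopologicalSpace Y] [MeasurableSpace Y]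
    [OpensMeasurableSpace Y] [T2Space Y]
    {S : Set (Measure (X × Y))} (h₁ : IsTightMeasureSet ((fun γ => γ.map Prod.fst) '' S))
    (h₂ : IsTightMeasureSet ((fun γ => γ.map Prod.snd) '' S)) : IsTightMeasureSet S := by
  rw [isTightMeasureSet_iff_exists_isCompact_measure_compl_le] at *
  intro ε hε
  obtain ⟨K, hK, hKε⟩ := h₁ (ε / 2) (ENNReal.half_pos hε.ne')
  obtain ⟨L, hL, hLε⟩ := h₂ (ε / 2) (ENNReal.half_pos hε.ne')
  refine ⟨K ×ˢ L, hK.prod hL, fun γ hγ => ?_⟩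
  have hK' := hKε _ ⟨γ, hγ, rfl⟩
  have hL' := hLε _ ⟨γ, hγ, rfl⟩
  rw [Measure.map_apply measurable_fst hK.measurableSet.compl] at hK'
  rw [Measure.map_apply measurable_snd hL.measurableSet.compl] at hL'
  calc γ (K ×ˢ L)ᶜ ≤ γ (Prod.fst ⁻¹' Kᶜ ∪ Prod.snd ⁻¹' Lᶜ) := by
        refine measure_mono fun p hp => ?_
        by_contra h
        simp only [Set.mem_union, Set.mem_preimage, Set.mem_compl_iff, not_or, not_not] at h
        exact hp h
    _ ≤ γ (Prod.fst ⁻¹' Kᶜ) + γ (Prod.snd ⁻¹' Lᶜ) := measure_union_le _ _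
    _ ≤ ε / 2 + ε / 2 := add_le_add hK' hL'
    _ = ε := ENNReal.add_halves ε

section Polish

variable {X : Type*} [TopologicalSpace X] [PolishSpace X] [MeasurableSpace X] [BorelSpace X]

/-- A convergent sequence together with its limit is compact, and on a Polish space relatively
compact sets of probability measures are tight. -/
theorem isTightMeasureSet_range_of_tendsto {μs : ℕ → ProbabilityMeasure X}
    {μ : ProbabilityMeasure X} (h : Tendsto μs atTop (𝓝 μ)) :
    IsTightMeasureSet (Set.range fun n => (μs n : Measure X)) := by
  let := TopologicalSpace.upgradeIsCompletelyMetrizable X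
  have hc : IsCompact (closure (Set.range μs)) :=
    h.isCompact_insert_range.closure_of_subset (Set.subset_insert _ _)
  refine (isTightMeasureSet_of_isCompact_closure hc).subset ?_
  rintro _ ⟨n, rfl⟩
  exact ⟨μs n, ⟨n, rfl⟩, rfl⟩

/-- Couplings of weakly convergent sequences have a subsequence that converges weakly to a
coupling of the limits. -/
theorem exists_subseq_tendsto_coupling {μs νs : ℕ → ProbabilityMeasure X}
    {μ ν : ProbabilityMeasure X} (hμ : Tendsto μs atTop (𝓝 μ)) (hν : Tendsto νs atTop (𝓝 ν))
    {γs : ℕ → ProbabilityMeasure (X × X)} (hγs : ∀ n, γs n ∈ couplings (μs n) (νs n)) :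
    ∃ γ ∈ couplings μ ν, ∃ φ : ℕ → ℕ, StrictMono φ ∧ Tendsto (γs ∘ φ) atTop (𝓝 γ) := by
  have htight : IsTightMeasureSet {((γ : ProbabilityMeasure (X × X)) : Measure (X × X)) |
      γ ∈ Set.range γs} := by
    refine isTightMeasureSet_of_marginals
      ((isTightMeasureSet_range_of_tendsto hμ).subset ?_)
      ((isTightMeasureSet_range_of_tendsto hν).subset ?_)
    · rintro _ ⟨_, ⟨_, ⟨n, rfl⟩, rfl⟩, rfl⟩
      exact ⟨n, (hγs n).1.symm⟩
    · rintro _ ⟨_, ⟨_, ⟨n, rfl⟩, rfl⟩, rfl⟩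
      exact ⟨n, (hγs n).2.symm⟩
  obtain ⟨γ, -, φ, hφ, hlim⟩ := (isCompact_closure_of_isTightMeasureSet htight).tendsto_subseq
    fun n => subset_closure (Set.mem_range_self n)
  -- Taking marginals is weakly continuous, so uniqueness of limits identifies those of `γ`.
  have h₁ : γ.map continuous_fst.measurable.aemeasurable = μ := by
    refine tendsto_nhds_unique ?_ (hμ.comp hφ.tendsto_atTop)
    refine (((ProbabilityMeasure.continuous_map continuous_fst).tendsto γ).comp hlim).congr
      fun n => Subtype.ext (hγs (φ n)).1
  have h₂ : γ.map continuous_snd.measurable.aemeasurable = ν := by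
    refine tendsto_nhds_unique ?_ (hν.comp hφ.tendsto_atTop)
    refine (((ProbabilityMeasure.continuous_map continuous_snd).tendsto γ).comp hlim).congr
      fun n => Subtype.ext (hγs (φ n)).2
  exact ⟨γ, ⟨congrArg Subtype.val h₁, congrArg Subtype.val h₂⟩, φ, hφ, hlim⟩

end Polish

/-! ### The optimal transport cost -/

section TransportCost

variable {X : Type*} [MeasurableSpace X] {k : X → X → ℝ}

theorem IsBoundedPseudometric.transportCost_le (hk : IsBoundedPseudometric k)
    {μ ν : ProbabilityMeasure X} {γ : ProbabilityMeasure (X × X)} (hγ : γ ∈ couplings μ ν) :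
    transportCost k μ ν ≤ ∫ p, k p.1 p.2 ∂(γ : Measure (X × X)) := by
  refine csInf_le ⟨0, ?_⟩ ⟨γ, hγ, rfl⟩
  rintro _ ⟨γ', -, rfl⟩
  exact integral_nonneg fun p => hk.nonneg _ _

theorem le_transportCost {μ ν : ProbabilityMeasure X} {r : ℝ}
    (h : ∀ γ ∈ couplings μ ν, r ≤ ∫ p, k p.1 p.2 ∂(γ : Measure (X × X))) :
    r ≤ transportCost k μ ν := by
  -- Nonemptiness matters: the real `sInf` of the empty set is `0`.
  refine le_csInf ((couplings_nonempty μ ν).image _) ?_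
  rintro _ ⟨γ, hγ, rfl⟩
  exact h γ hγ

theorem IsBoundedPseudometric.transportCost_nonneg (hk : IsBoundedPseudometric k)
    (μ ν : ProbabilityMeasure X) : 0 ≤ transportCost k μ ν :=
  le_transportCost fun _ _ => integral_nonneg fun _ => hk.nonneg _ _

end TransportCost

section Polish

variable {X : Type*} [TopologicalSpace X] [PolishSpace X] [MeasurableSpace X] [BorelSpace X]
  {k k' : X → X → ℝ}

theorem IsLscPseudometric.integrable (hk : IsLscPseudometric k) (γ : Measure (X × X))
    [IsFiniteMeasure γ] : Integrable (fun p : X × X => k p.1 p.2) γ :=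
  integrable_of_lowerSemicontinuous hk.lsc (fun _ => hk.nonneg _ _) (fun _ => hk.le_one _ _) γ

theorem IsLscPseudometric.integral_le_of_tendsto (hk : IsLscPseudometric k)
    {γs : ℕ → ProbabilityMeasure (X × X)} {γ : ProbabilityMeasure (X × X)}
    (hγ : Tendsto γs atTop (𝓝 γ)) {r : ℝ}
    (hr : ∀ᶠ n in atTop, ∫ p, k p.1 p.2 ∂(γs n : Measure (X × X)) ≤ r) :
    ∫ p, k p.1 p.2 ∂(γ : Measure (X × X)) ≤ r :=
  TrajectoryMetric.integral_le_of_tendsto hk.lsc (fun _ => hk.nonneg _ _)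
    (fun _ => hk.le_one _ _) hγ hr

/-- An optimal coupling exists. -/
theorem IsLscPseudometric.exists_optimal (hk : IsLscPseudometric k) (μ ν : ProbabilityMeasure X) :
    ∃ γ ∈ couplings μ ν, ∫ p, k p.1 p.2 ∂(γ : Measure (X × X)) = transportCost k μ ν := by
  have hex : ∀ n : ℕ, ∃ γ ∈ couplings μ ν,
      ∫ p, k p.1 p.2 ∂(γ : Measure (X × X)) < transportCost k μ ν + 1 / ((n : ℝ) + 1) := fun n => by
    obtain ⟨_, ⟨γ, hγ, rfl⟩, hlt⟩ := exists_lt_of_csInf_lt ((couplings_nonempty μ ν).image _)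
      (lt_add_of_pos_right (transportCost k μ ν) (Nat.one_div_pos_of_nat (n := n)))
    exact ⟨γ, hγ, hlt⟩
  choose γs hγs hlt using hex
  obtain ⟨γ, hγ, φ, hφ, hlim⟩ :=
    exists_subseq_tendsto_coupling tendsto_const_nhds tendsto_const_nhds hγs
  refine ⟨γ, hγ, le_antisymm (le_of_forall_pos_lt_add fun ε hε => ?_) (hk.transportCost_le hγ)⟩
  have hε2 : 0 < ε / 2 := half_pos hε
  have hev : ∀ᶠ n in atTop, ∫ p, k p.1 p.2 ∂((γs ∘ φ) n : Measure (X × X)) ≤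
      transportCost k μ ν + ε / 2 := by
    filter_upwards [hφ.tendsto_atTop.eventually
      ((tendsto_one_div_add_atTop_nhds_zero_nat (𝕜 := ℝ)).eventually_lt_const hε2)] with n hn
    have := hlt (φ n)
    simp only [Function.comp_apply]
    linarith
  linarith [hk.integral_le_of_tendsto hlim hev]

theorem IsLscPseudometric.transportCost_mono (hk : IsLscPseudometric k)
    (hk' : IsLscPseudometric k') (hle : ∀ x y, k x y ≤ k' x y) (μ ν : ProbabilityMeasure X) :
    transportCost k μ ν ≤ transportCost k' μ ν :=
  le_transportCost fun _ hγ => (hk.transportCost_le hγ).trans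
    (integral_mono (hk.integrable _) (hk'.integrable _) fun p => hle p.1 p.2)

/-- Sublevel sets of the transport cost are closed under weak convergence. -/
theorem IsLscPseudometric.transportCost_le_of_tendsto (hk : IsLscPseudometric k)
    {μs νs : ℕ → ProbabilityMeasure X} {μ ν : ProbabilityMeasure X}
    (hμ : Tendsto μs atTop (𝓝 μ)) (hν : Tendsto νs atTop (𝓝 ν)) {r : ℝ}
    (hr : ∀ n, transportCost k (μs n) (νs n) ≤ r) : transportCost k μ ν ≤ r := by
  choose γs hγs hopt using fun n => hk.exists_optimal (μs n) (νs n)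
  obtain ⟨γ, hγ, φ, -, hlim⟩ := exists_subseq_tendsto_coupling hμ hν hγs
  exact (hk.transportCost_le hγ).trans (hk.integral_le_of_tendsto hlim
    (Eventually.of_forall fun n => (hopt (φ n)).trans_le (hr (φ n))))

/-- Diagonal, swapped and glued couplings give the last three axioms. Gluing optimal couplings
avoids an approximation argument in the triangle inequality. -/
theorem isBoundedPseudometric_transportCost (hk : IsLscPseudometric k) :
    IsBoundedPseudometric (transportCost k) where
  nonneg := hk.transportCost_nonneg
  le_one μ ν := by
    obtain ⟨γ, hγ⟩ := couplings_nonempty μ ν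
    refine (hk.transportCost_le hγ).trans ?_
    calc ∫ p, k p.1 p.2 ∂(γ : Measure (X × X)) ≤ ∫ _, (1 : ℝ) ∂(γ : Measure (X × X)) :=
          integral_mono (hk.integrable _) (integrable_const _) fun p => hk.le_one _ _
      _ = 1 := by simp
  self μ := by
    refine le_antisymm ((hk.transportCost_le (diag_mem_couplings μ)).trans_eq ?_)
      (hk.transportCost_nonneg μ μ)
    rw [ProbabilityMeasure.toMeasure_map, integral_map (by fun_prop)
      hk.lsc.measurable.aestronglyMeasurable]
    simp [hk.self]
  symm := by
    have h : ∀ μ ν, transportCost k μ ν ≤ transportCost k ν μ := fun μ ν => by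
      refine le_transportCost fun γ hγ => (hk.transportCost_le (swap_mem_couplings hγ)).trans_eq ?_
      rw [ProbabilityMeasure.toMeasure_map, integral_map (by fun_prop)
        hk.lsc.measurable.aestronglyMeasurable]
      exact integral_congr_ae (ae_of_all _ fun p => hk.symm _ _)
    exact fun μ ν => le_antisymm (h μ ν) (h ν μ)
  triangle μ ν ρ := by
    obtain ⟨γ₁, h₁, hopt₁⟩ := hk.exists_optimal μ ν
    obtain ⟨γ₂, h₂, hopt₂⟩ := hk.exists_optimal ν ρ
    obtain ⟨τ, hτ₁, hτ₂⟩ := exists_gluing h₁ h₂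
    have hm : Measurable fun p : X × X × X => p.2 := measurable_snd
    have hm₁ : Measurable fun p : X × X × X => (p.2.1, p.1) := by fun_prop
    have hm₂ : Measurable fun p : X × X × X => (p.1, p.2.2) := by fun_prop
    have hγ : τ.map hm.aemeasurable ∈ couplings μ ρ := by
      refine ⟨?_, ?_⟩
      · rw [← h₁.1, ← hτ₁, ProbabilityMeasure.toMeasure_map, Measure.map_map measurable_fst hm,
          Measure.map_map measurable_fst hm₁]
        rfl
      · rw [← h₂.2, ← hτ₂, ProbabilityMeasure.toMeasure_map, Measure.map_map measurable_snd hm,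
          Measure.map_map measurable_snd hm₂]
        rfl
    have hkint : ∀ {g : X × X × X → X × X}, Measurable g →
        Integrable (fun p => k (g p).1 (g p).2) (τ : Measure (X × X × X)) := fun {g} hg =>
      have : IsProbabilityMeasure ((τ : Measure (X × X × X)).map g) :=
        Measure.isProbabilityMeasure_map hg.aemeasurable
      (hk.integrable ((τ : Measure (X × X × X)).map g)).comp_measurable hg
    calc transportCost k μ ρ
        ≤ ∫ p, k p.2.1 p.2.2 ∂(τ : Measure (X × X × X)) := by
          refine (hk.transportCost_le hγ).trans_eq ?_
          rw [ProbabilityMeasure.toMeasure_map, integral_map hm.aemeasurable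
            hk.lsc.measurable.aestronglyMeasurable]
      _ ≤ ∫ p, (k p.2.1 p.1 + k p.1 p.2.2) ∂(τ : Measure (X × X × X)) :=
          integral_mono (hkint hm) ((hkint hm₁).add (hkint hm₂)) fun p => hk.triangle _ _ _
      _ = ∫ p, k p.2.1 p.1 ∂(τ : Measure (X × X × X)) +
            ∫ p, k p.1 p.2.2 ∂(τ : Measure (X × X × X)) := integral_add (hkint hm₁) (hkint hm₂)
      _ = transportCost k μ ν + transportCost k ν ρ := by
          rw [← hopt₁, ← hopt₂, ← hτ₁, ← hτ₂, integral_map hm₁.aemeasurable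
            hk.lsc.measurable.aestronglyMeasurable, integral_map hm₂.aemeasurable
            hk.lsc.measurable.aestronglyMeasurable]

/-- A bound on the transport costs of an increasing sequence of cost functions passes to the limit. -/
theorem transportCost_le_of_monotone_tendsto {ks : ℕ → X → X → ℝ}
    (hks : ∀ n, IsLscPseudometric (ks n)) (hk : IsLscPseudometric k)
    (hmono : ∀ x y, Monotone fun n => ks n x y)
    (hlim : ∀ x y, Tendsto (fun n => ks n x y) atTop (𝓝 (k x y))) {μ ν : ProbabilityMeasure X}
    {r : ℝ} (hr : ∀ n, transportCost (ks n) μ ν ≤ r) : transportCost k μ ν ≤ r := by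
  choose γs hγs hopt using fun n => (hks n).exists_optimal μ ν
  obtain ⟨γ, hγ, φ, hφ, hγlim⟩ :=
    exists_subseq_tendsto_coupling tendsto_const_nhds tendsto_const_nhds hγs
  -- Monotone convergence under the fixed `γ` leaves a bound for each single `ks m`. That bound
  -- comes from the tail of the subsequence, where `m ≤ n ≤ φ n` gives `ks m ≤ ks (φ n)`.
  refine (hk.transportCost_le hγ).trans (le_of_tendsto' (integral_tendsto_of_tendsto_of_monotone
    (fun n => (hks n).integrable (γ : Measure (X × X))) (hk.integrable _)
    (ae_of_all _ fun p => hmono p.1 p.2) (ae_of_all _ fun p => hlim p.1 p.2)) fun m => ?_)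
  refine (hks m).integral_le_of_tendsto hγlim ?_
  filter_upwards [eventually_ge_atTop m] with n hn
  calc ∫ p, ks m p.1 p.2 ∂((γs ∘ φ) n : Measure (X × X))
      ≤ ∫ p, ks (φ n) p.1 p.2 ∂((γs ∘ φ) n : Measure (X × X)) :=
        integral_mono ((hks m).integrable _) ((hks (φ n)).integrable _)
          fun p => hmono p.1 p.2 (hn.trans (hφ.id_le n))
    _ ≤ r := (hopt (φ n)).trans_le (hr (φ n))

end Polish

/-! ### Suprema of pseudometrics -/

/-- The common bound `1` keeps every real supremum from taking its default value. This serves both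
the supremum over times and the one over iterates. -/
theorem isLscPseudometric_iSup {X ι : Type*} [TopologicalSpace X] [Nonempty ι]
    {ks : ι → X → X → ℝ} (hks : ∀ i, IsLscPseudometric (ks i)) :
    IsLscPseudometric fun x y => ⨆ i, ks i x y := by
  have hbdd : ∀ x y, BddAbove (Set.range fun i => ks i x y) := fun x y =>
    ⟨1, by rintro _ ⟨i, rfl⟩; exact (hks i).le_one x y⟩
  refine ⟨⟨?_, ?_, ?_, ?_, ?_⟩, ?_⟩
  · exact fun x y => Real.iSup_nonneg fun i => (hks i).nonneg x y
  · exact fun x y => ciSup_le fun i => (hks i).le_one x y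
  · exact fun x => by simp [(hks _).self]
  · exact fun x y => by simp only [(hks _).symm x y]
  · exact fun x y z => ciSup_le fun i => ((hks i).triangle x y z).trans
      (add_le_add (le_ciSup (hbdd x y) i) (le_ciSup (hbdd y z) i))
  · exact lowerSemicontinuous_ciSup (fun p => hbdd p.1 p.2) fun i => (hks i).lsc

/-! ### The discounted uniform pseudometric -/

section DiscountedUniform

variable {E : Type*} [TopologicalSpace E] {c : ℝ} {m m' : E → E → ℝ}

theorem isLscPseudometric_discounted_eval (hm : IsLscPseudometric m) (hc0 : 0 < c) (hc1 : c < 1)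
    (t : ℝ≥0) :
    IsLscPseudometric fun ω ω' : Trajectory E => c ^ (t : ℝ) * m (ω t) (ω' t) := by
  have hct0 : 0 ≤ c ^ (t : ℝ) := Real.rpow_nonneg hc0.le _
  have hct1 : c ^ (t : ℝ) ≤ 1 := Real.rpow_le_one hc0.le hc1.le t.coe_nonneg
  refine ⟨⟨?_, ?_, ?_, ?_, ?_⟩, ?_⟩
  · exact fun ω ω' => mul_nonneg hct0 (hm.nonneg _ _)
  · exact fun ω ω' => mul_le_one₀ hct1 (hm.nonneg _ _) (hm.le_one _ _)
  · exact fun ω => by rw [hm.self, mul_zero]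
  · exact fun ω ω' => by rw [hm.symm]
  · exact fun ω ω' ω'' => by
      rw [← mul_add]
      exact mul_le_mul_of_nonneg_left (hm.triangle _ _ _) hct0
  · have hev : Continuous fun p : Trajectory E × Trajectory E => (p.1 t, p.2 t) :=
      ((continuous_eval_const t).comp continuous_fst).prodMk
        ((continuous_eval_const t).comp continuous_snd)
    exact (continuous_const.mul continuous_id).comp_lowerSemicontinuous
      (hm.lsc.comp hev) fun a b hab => mul_le_mul_of_nonneg_left hab hct0

theorem isLscPseudometric_discountedUniform (hm : IsLscPseudometric m) (hc0 : 0 < c)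
    (hc1 : c < 1) : IsLscPseudometric (discountedUniform c m) :=
  isLscPseudometric_iSup fun t => isLscPseudometric_discounted_eval hm hc0 hc1 t

theorem le_discountedUniform (hm : IsLscPseudometric m) (hc0 : 0 < c) (hc1 : c < 1)
    (ω ω' : Trajectory E) (t : ℝ≥0) :
    c ^ (t : ℝ) * m (ω t) (ω' t) ≤ discountedUniform c m ω ω' :=
  le_ciSup (f := fun t : ℝ≥0 => c ^ (t : ℝ) * m (ω t) (ω' t)) ⟨1, by
    rintro _ ⟨s, rfl⟩
    exact (isLscPseudometric_discounted_eval hm hc0 hc1 s).le_one ω ω'⟩ t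

theorem discountedUniform_mono (hm' : IsLscPseudometric m') (hc0 : 0 < c) (hc1 : c < 1)
    (hle : m ≤ m') (ω ω' : Trajectory E) :
    discountedUniform c m ω ω' ≤ discountedUniform c m' ω ω' :=
  ciSup_le fun t => (mul_le_mul_of_nonneg_left (hle _ _) (Real.rpow_nonneg hc0.le _)).trans
    (le_discountedUniform hm' hc0 hc1 ω ω' t)

/-- The suprema over `n` and over `t` commute, so no uniformity in `t` is needed. -/
theorem tendsto_discountedUniform {ms : ℕ → E → E → ℝ} (hms : ∀ n, IsLscPseudometric (ms n))
    (hm : IsLscPseudometric m) (hc0 : 0 < c) (hc1 : c < 1) (hmono : Monotone ms)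
    (hlim : ∀ x y, Tendsto (fun n => ms n x y) atTop (𝓝 (m x y))) (ω ω' : Trajectory E) :
    Tendsto (fun n => discountedUniform c (ms n) ω ω') atTop (𝓝 (discountedUniform c m ω ω')) := by
  have hle : ∀ n, ms n ≤ m := fun n x y =>
    Monotone.ge_of_tendsto (fun i j hij => hmono hij x y) (hlim x y) n
  refine tendsto_atTop_isLUB
    (fun i j hij => discountedUniform_mono (hms j) hc0 hc1 (hmono hij) ω ω') ⟨?_, ?_⟩
  · rintro _ ⟨n, rfl⟩
    exact discountedUniform_mono hm hc0 hc1 (hle n) ω ω'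
  · intro b hb
    refine ciSup_le fun t => le_of_tendsto' ((hlim (ω t) (ω' t)).const_mul _) fun n => ?_
    exact (le_discountedUniform (hms n) hc0 hc1 ω ω' t).trans (hb ⟨n, rfl⟩)

end DiscountedUniform

/-! ### The functional -/

section Functional

variable {E : Type*} [TopologicalSpace E] [MeasurableSpace E]

theorem Diffusion.ae_eval_zero_eq [T1Space E] [BorelSpace E] (D : Diffusion E) (x : E) :
    ∀ᵐ ω ∂(D.law x : Measure (Trajectory E)), ω 0 = x := by
  -- With no later times, the cylinder formula reduces to `δ_x({x}) = 1`.
  have h := D.isLawFrom x {x} [] (measurableSet_singleton x) (by simp) (by simp)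
  simp only [cylinderProb, List.not_mem_nil, false_implies, implies_true, and_true] at h
  have hset : MeasurableSet {ω : Trajectory E | ω 0 ∈ ({x} : Set E)} :=
    measurable_trajectory_eval 0 (measurableSet_singleton x)
  refine (mem_ae_iff_prob_eq_one hset).2 ?_
  rw [h]
  simp

variable [LocallyCompactSpace E] [T2Space E] [SecondCountableTopology E] [BorelSpace E]
  (D : Diffusion E) {c : ℝ} {m m' : E → E → ℝ}

/-- The functional preserves the lower semicontinuous bounded pseudometrics. -/
theorem Diffusion.isLscPseudometric_functional (hc0 : 0 < c) (hc1 : c < 1)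
    (hm : IsLscPseudometric m) : IsLscPseudometric (D.functional c m) := by
  have := polishSpace_of_locallyCompactSpace E
  have := polishSpace_trajectory E
  have := borelSpace_trajectory E
  have hU := isLscPseudometric_discountedUniform hm hc0 hc1
  have hW := isBoundedPseudometric_transportCost hU
  refine ⟨⟨fun _ _ => hW.nonneg _ _, fun _ _ => hW.le_one _ _, fun _ => hW.self _,
    fun _ _ => hW.symm _ _, fun _ _ _ => hW.triangle _ _ _⟩, ?_⟩
  -- Closedness of sublevel sets may be tested on sequences in `E × E`, which is the form in which
  -- weak continuity of the laws is given.
  refine lowerSemicontinuous_iff_isClosed_preimage.2 fun r => IsSeqClosed.isClosed ?_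
  intro u p hu hp
  have hlaw : ∀ {v : ℕ → E} {x : E}, Tendsto v atTop (𝓝 x) →
      Tendsto (fun n => D.law (v n)) atTop (𝓝 (D.law x)) := fun hv =>
    ProbabilityMeasure.tendsto_iff_forall_integral_tendsto.2 (D.weakly_continuous _ _ hv)
  exact hU.transportCost_le_of_tendsto (hlaw ((continuous_fst.tendsto p).comp hp))
    (hlaw ((continuous_snd.tendsto p).comp hp)) hu

theorem Diffusion.functional_mono (hc0 : 0 < c) (hc1 : c < 1) (hm : IsLscPseudometric m)
    (hm' : IsLscPseudometric m') (hle : m ≤ m') : D.functional c m ≤ D.functional c m' := by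
  have := polishSpace_of_locallyCompactSpace E
  have := polishSpace_trajectory E
  have := borelSpace_trajectory E
  exact fun x y => (isLscPseudometric_discountedUniform hm hc0 hc1).transportCost_mono
    (isLscPseudometric_discountedUniform hm' hc0 hc1) (discountedUniform_mono hm' hc0 hc1 hle) _ _

/-- The functional is inflationary: at time `0` the trajectories are at their starting points. -/
theorem Diffusion.le_functional (hc0 : 0 < c) (hc1 : c < 1) (hm : IsLscPseudometric m) :
    m ≤ D.functional c m := by
  have := polishSpace_of_locallyCompactSpace E
  have := polishSpace_trajectory E
  have := borelSpace_trajectory E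
  have hU := isLscPseudometric_discountedUniform hm hc0 hc1
  intro x y
  refine le_transportCost fun γ hγ => ?_
  have hx : ∀ᵐ p ∂(γ : Measure (Trajectory E × Trajectory E)), p.1 0 = x :=
    ae_of_ae_map measurable_fst.aemeasurable (hγ.1 ▸ D.ae_eval_zero_eq x)
  have hy : ∀ᵐ p ∂(γ : Measure (Trajectory E × Trajectory E)), p.2 0 = y :=
    ae_of_ae_map measurable_snd.aemeasurable (hγ.2 ▸ D.ae_eval_zero_eq y)
  calc m x y = ∫ _, m x y ∂(γ : Measure (Trajectory E × Trajectory E)) := by simp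
    _ ≤ _ := by
      refine integral_mono_ae (integrable_const _) (hU.integrable _) ?_
      filter_upwards [hx, hy] with p hpx hpy
      -- Only the term at `t = 0` of the supremum is kept; its discount is `c ^ 0 = 1`.
      simpa [hpx, hpy] using le_discountedUniform hm hc0 hc1 p.1 p.2 0

theorem isLscPseudometric_obsDist {E : Type*} [TopologicalSpace E] (obs : C(E, unitInterval)) :
    IsLscPseudometric (obsDist obs) where
  nonneg _ _ := abs_nonneg _
  le_one x y := abs_sub_le_iff.2
    ⟨by linarith [(obs x).2.2, (obs y).2.1], by linarith [(obs y).2.2, (obs x).2.1]⟩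
  self x := by simp [obsDist]
  symm x y := abs_sub_comm _ _
  triangle x y z := abs_sub_le _ _ _
  lsc := by
    refine Continuous.lowerSemicontinuous ?_
    unfold obsDist
    fun_prop

variable (obs : C(E, unitInterval))

theorem Diffusion.isLscPseudometric_iterate (hc0 : 0 < c) (hc1 : c < 1) (n : ℕ) :
    IsLscPseudometric (D.iterate obs c n) := by
  induction n with
  | zero => exact isLscPseudometric_obsDist obs
  | succ n ih => exact D.isLscPseudometric_functional hc0 hc1 ih

theorem Diffusion.monotone_iterate (hc0 : 0 < c) (hc1 : c < 1) : Monotone (D.iterate obs c) :=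
  monotone_nat_of_le_succ fun n =>
    D.le_functional hc0 hc1 (D.isLscPseudometric_iterate obs hc0 hc1 n)

theorem Diffusion.isLscPseudometric_dbar (hc0 : 0 < c) (hc1 : c < 1) :
    IsLscPseudometric (D.dbar obs c) :=
  isLscPseudometric_iSup (D.isLscPseudometric_iterate obs hc0 hc1)

theorem Diffusion.bddAbove_iterate (hc0 : 0 < c) (hc1 : c < 1) (x y : E) :
    BddAbove (Set.range fun n => D.iterate obs c n x y) :=
  ⟨1, by rintro _ ⟨n, rfl⟩; exact (D.isLscPseudometric_iterate obs hc0 hc1 n).le_one x y⟩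

theorem Diffusion.iterate_le_dbar (hc0 : 0 < c) (hc1 : c < 1) (n : ℕ) :
    D.iterate obs c n ≤ D.dbar obs c := fun x y =>
  le_ciSup (D.bddAbove_iterate obs hc0 hc1 x y) n

theorem Diffusion.functional_dbar (hc0 : 0 < c) (hc1 : c < 1) :
    D.functional c (D.dbar obs c) = D.dbar obs c := by
  have := polishSpace_of_locallyCompactSpace E
  have := polishSpace_trajectory E
  have := borelSpace_trajectory E
  have hd := D.isLscPseudometric_dbar obs hc0 hc1
  have hi := D.isLscPseudometric_iterate obs hc0 hc1
  have hmono := D.monotone_iterate obs hc0 hc1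
  refine le_antisymm (fun x y => ?_) (D.le_functional hc0 hc1 hd)
  refine transportCost_le_of_monotone_tendsto
    (fun n => isLscPseudometric_discountedUniform (hi n) hc0 hc1)
    (isLscPseudometric_discountedUniform hd hc0 hc1)
    (fun ω ω' i j hij => discountedUniform_mono (hi j) hc0 hc1 (hmono hij) ω ω')
    (tendsto_discountedUniform hi hd hc0 hc1 hmono fun x y =>
      tendsto_atTop_ciSup (fun i j hij => hmono hij x y) (D.bddAbove_iterate obs hc0 hc1 x y))
    -- The index shifts because the transport cost for `U_c(dₙ)` is by definition `dₙ₊₁`.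
    fun n => D.iterate_le_dbar obs hc0 hc1 (n + 1) x y

theorem Diffusion.iterate_le_of_functional_eq (hc0 : 0 < c) (hc1 : c < 1)
    (hm : IsLscPseudometric m) (hfix : D.functional c m = m) (hobs : obsDist obs ≤ m) (n : ℕ) :
    D.iterate obs c n ≤ m := by
  induction n with
  | zero => exact hobs
  | succ n ih =>
    exact (D.functional_mono hc0 hc1 (D.isLscPseudometric_iterate obs hc0 hc1 n) hm ih).trans_eq
      hfix

end Functional

end TrajectoryMetric

theorem mainTheorem2 {E : Type*} [TopologicalSpace E] [LocallyCompactSpace E] [T2Space E]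
    [SecondCountableTopology E] [MeasurableSpace E] [BorelSpace E]
    (D : TrajectoryMetric.Diffusion E) (obs : C(E, unitInterval)) (c : ℝ)
    (hc0 : 0 < c) (hc1 : c < 1) :
    IsLeast {m : E → E → ℝ | TrajectoryMetric.IsLscPseudometric m ∧ D.functional c m = m ∧
        TrajectoryMetric.obsDist obs ≤ m}
      (D.dbar obs c) := by
  refine ⟨⟨D.isLscPseudometric_dbar obs hc0 hc1, D.functional_dbar obs hc0 hc1,
    D.iterate_le_dbar obs hc0 hc1 0⟩, ?_⟩
  rintro m ⟨hm, hfix, hobs⟩ x y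
  exact ciSup_le fun n => D.iterate_le_of_functional_eq obs hc0 hc1 hm hfix hobs n x y
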